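/- Let $(M,\omega)$ be a two-dimensional symplectic manifold (a smooth surface without boundary, not necessarily compact or connected, with a smooth closed nondegenerate 2-form $\omega$). For $F,G\in C^\infty(M)$ (real-valued) let the Poisson bracket $\{F,G\}\in C^\infty(M)$ be defined by $-dF\wedge dG=\{F,G\}\,\omega$, and for a function $f:M\to\mathbb R$ let $\|f\|=\sup_{z\in M}|f(z)|\in[0,\infty]$ be its supremum norm (equal to $\infty$ if $f$ is unbounded). Define $$\Upsilon(F,G)=\liminf_{\varepsilon\to 0^+}\ \inf\big\{\|\{F',G'\}\| \,:\, F',G'\in C^\infty(M),\ \|F-F'\|<\varepsilon,\ \|G-G'\|<\varepsilon\big\}\in[0,\infty].$$ Then for all $F,G\in C^\infty(M)$, $$\Upsilon(F,G)=\|\{F,G\}\|$$ as elements of $[0,\infty]$; in particular, if $\{F,G\}$ is unbounded, then $\Upsilon(F,G)=\infty$. -/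

import Mathlib

open scoped Manifold ContDiff Topology ENNReal

noncomputable section

/-- The pullback of a field `Ω` of 2-forms on an `m`-dimensional manifold `M` by the inverse of the
chart at `z₀`, i.e. the coordinate expression of `Ω` in that chart
(meaningful on the target of the chart). -/
def formInChart {m : ℕ} {M : Type*} [TopologicalSpace M] [ChartedSpace (EuclideanSpace ℝ (Fin m)) M]
    (Ω : ∀ z : M, TangentSpace (𝓡 m) z [⋀^Fin 2]→L[ℝ] ℝ) (z₀ : M)
    (y : EuclideanSpace ℝ (Fin m)) : EuclideanSpace ℝ (Fin m) [⋀^Fin 2]→L[ℝ] ℝ :=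
  (Ω ((extChartAt (𝓡 m) z₀).symm y)).compContinuousLinearMap
    (mfderiv 𝓘(ℝ, EuclideanSpace ℝ (Fin m)) (𝓡 m) (extChartAt (𝓡 m) z₀).symm y)

/-- A symplectic form on an `m`-dimensional manifold (without boundary):
a smooth, closed, nondegenerate differential 2-form. -/
structure SymplecticForm (m : ℕ) (M : Type*) [TopologicalSpace M]
    [ChartedSpace (EuclideanSpace ℝ (Fin m)) M] where
  /-- The alternating bilinear form on each tangent space. -/
  form : ∀ z : M, TangentSpace (𝓡 m) z [⋀^Fin 2]→L[ℝ] ℝ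
  smooth : ∀ z₀ : M, ContDiffOn ℝ ∞ (formInChart form z₀) (extChartAt (𝓡 m) z₀).target
  closed : ∀ z₀ : M, ∀ y ∈ (extChartAt (𝓡 m) z₀).target, extDeriv (formInChart form z₀) y = 0
  nondegenerate : ∀ (z : M) (v : TangentSpace (𝓡 m) z),
    (∀ w : TangentSpace (𝓡 m) z, form z ![v, w] = 0) → v = 0

section Surface

variable {M : Type*} [TopologicalSpace M] [ChartedSpace (EuclideanSpace ℝ (Fin 2)) M]

/-- The differential `dF` at the point `z`, as a covector. -/
def differential (F : C^∞⟮𝓡 2, M; 𝓘(ℝ, ℝ), ℝ⟯) (z : M) : TangentSpace (𝓡 2) z →L[ℝ] ℝ :=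
  mfderiv (𝓡 2) 𝓘(ℝ, ℝ) F z

/-- The value `(dF ∧ dG)(v, w)` at the point `z`. -/
def wedgeDifferentials (F G : C^∞⟮𝓡 2, M; 𝓘(ℝ, ℝ), ℝ⟯) (z : M) (v w : TangentSpace (𝓡 2) z) : ℝ :=
  differential F z v * differential G z w - differential F z w * differential G z v

/-- The `i`-th coordinate vector of the tangent space at `z`. -/
def tangentBasisVector (z : M) (i : Fin 2) : TangentSpace (𝓡 2) z :=
  (EuclideanSpace.single i (1 : ℝ) : EuclideanSpace ℝ (Fin 2))

/-- The Poisson bracket of two smooth functions on a symplectic surface, with the sign convention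
`-dF ∧ dG = {F, G} Ω`. It is the quotient of the two top-degree forms `-dF ∧ dG` and `Ω`, evaluated
on a basis of the tangent space; see `eq_poissonBracket_iff` for the defining property. -/
def poissonBracket (Ω : SymplecticForm 2 M) (F G : C^∞⟮𝓡 2, M; 𝓘(ℝ, ℝ), ℝ⟯) (z : M) : ℝ :=
  -wedgeDifferentials F G z (tangentBasisVector z 0) (tangentBasisVector z 1) /
    Ω.form z ![tangentBasisVector z 0, tangentBasisVector z 1]

theorem tangentBasis_decomp (z : M) (v : TangentSpace (𝓡 2) z) :
    ∃ a b : ℝ, v = a • tangentBasisVector z 0 + b • tangentBasisVector z 1 := by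
  refine ⟨(show EuclideanSpace ℝ (Fin 2) from v) 0, (show EuclideanSpace ℝ (Fin 2) from v) 1, ?_⟩
  change (show EuclideanSpace ℝ (Fin 2) from v) =
    (show EuclideanSpace ℝ (Fin 2) from v) 0 • EuclideanSpace.single (0 : Fin 2) (1 : ℝ) +
    (show EuclideanSpace ℝ (Fin 2) from v) 1 • EuclideanSpace.single (1 : Fin 2) (1 : ℝ)
  ext i
  fin_cases i <;> simp

theorem form_add_left {V : Type*} [AddCommGroup V] [Module ℝ V] [TopologicalSpace V]
    (η : V [⋀^Fin 2]→L[ℝ] ℝ) (a b : ℝ) (u v w : V) :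
    η ![a • u + b • v, w] = a * η ![u, w] + b * η ![v, w] := by
  have h := η.map_update_add ![u, w] 0 (a • u) (b • v)
  have h1 := η.map_update_smul ![u, w] 0 a u
  have h2 := η.map_update_smul ![u, w] 0 b v
  have e : ∀ x, Function.update ![u, w] 0 x = ![x, w] := by
    intro x; funext i; fin_cases i <;> simp
  simp only [e, smul_eq_mul] at h h1 h2
  rw [h, h1, h2]

theorem form_swap {V : Type*} [AddCommGroup V] [Module ℝ V] [TopologicalSpace V]
    (η : V [⋀^Fin 2]→L[ℝ] ℝ) (u v : V) : η ![u, v] = -η ![v, u] := by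
  have h := η.toAlternatingMap.map_swap ![v, u] (i := 0) (j := 1) (by decide)
  rw [show ![v, u] ∘ (Equiv.swap (0 : Fin 2) 1) = ![u, v] from by
    ext i; fin_cases i <;> simp] at h
  exact h

theorem form_comb {V : Type*} [AddCommGroup V] [Module ℝ V] [TopologicalSpace V]
    (η : V [⋀^Fin 2]→L[ℝ] ℝ) (a b c d : ℝ) (u v : V) :
    η ![a • u + b • v, c • u + d • v] = (a * d - b * c) * η ![u, v] := by
  have hu : η ![u, u] = 0 := by have := form_swap η u u; linarith
  have hv : η ![v, v] = 0 := by have := form_swap η v v; linarith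
  rw [form_add_left, form_swap η u, form_swap η v, form_add_left, form_add_left, hu, hv,
    form_swap η v u]
  ring

theorem SymplecticForm.apply_basis_ne_zero (Ω : SymplecticForm 2 M) (z : M) :
    Ω.form z ![tangentBasisVector z 0, tangentBasisVector z 1] ≠ 0 := by
  intro h
  have h0 : tangentBasisVector z 0 = 0 := by
    refine Ω.nondegenerate z _ fun w => ?_
    obtain ⟨a, b, rfl⟩ := tangentBasis_decomp z w
    have := form_comb (Ω.form z) 1 0 a b (tangentBasisVector z 0) (tangentBasisVector z 1)
    simpa [h] using this
  have h1 : (EuclideanSpace.single (0 : Fin 2) (1 : ℝ) : EuclideanSpace ℝ (Fin 2)) = 0 := h0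
  simp at h1

/-- The Poisson bracket is the unique function satisfying `-dF ∧ dG = {F, G} Ω`. -/
theorem eq_poissonBracket_iff (Ω : SymplecticForm 2 M) (F G : C^∞⟮𝓡 2, M; 𝓘(ℝ, ℝ), ℝ⟯) (z : M)
    (c : ℝ) : c = poissonBracket Ω F G z ↔
      ∀ v w : TangentSpace (𝓡 2) z, -wedgeDifferentials F G z v w = c * Ω.form z ![v, w] := by
  have hne := Ω.apply_basis_ne_zero z
  constructor
  · rintro rfl v w
    obtain ⟨a, b, rfl⟩ := tangentBasis_decomp z v
    obtain ⟨c, d, rfl⟩ := tangentBasis_decomp z w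
    rw [form_comb, poissonBracket]
    field_simp
    simp only [wedgeDifferentials, map_add, map_smul, smul_eq_mul]
    ring
  · intro h
    rw [poissonBracket, eq_div_iff hne, h]

/-- The supremum norm `‖f‖ = sup |f|`, with values in `[0, ∞]` (infinite if `f` is unbounded). -/
def supNorm {X : Type*} (f : X → ℝ) : ℝ≥0∞ := ⨆ x, ‖f x‖ₑ

/-- `Υ(F, G)`: the lower limit, as `ε → 0⁺`, of the infimum of `‖{F', G'}‖` over all smooth
`F', G'` with `‖F - F'‖ < ε` and `‖G - G'‖ < ε`. -/
def upsilon (Ω : SymplecticForm 2 M) (F G : C^∞⟮𝓡 2, M; 𝓘(ℝ, ℝ), ℝ⟯) : ℝ≥0∞ :=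
  Filter.liminf
    (fun ε : ℝ => ⨅ (F' : C^∞⟮𝓡 2, M; 𝓘(ℝ, ℝ), ℝ⟯) (G' : C^∞⟮𝓡 2, M; 𝓘(ℝ, ℝ), ℝ⟯)
      (_ : supNorm (fun z => F z - F' z) < ENNReal.ofReal ε)
      (_ : supNorm (fun z => G z - G' z) < ENNReal.ofReal ε),
      supNorm (poissonBracket Ω F' G'))
    (𝓝[>] (0 : ℝ))

end Surface

end

/-! Taking `F' = F`, `G' = G` gives one inequality. The other is lower semicontinuity of `‖{F, G}‖`
under uniform perturbation, which is local and rests on Stokes' theorem.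

In a chart, suppose `|{F, G}| > c` at a point. There `(F, G)` has injective differential, so on an
annulus around the point it stays away from its central value. Pull back `α(s) β(t) ds ∧ dt`, a bump
form at that value. Its integral over the inner ball is the same for every nearby `(F', G')`:
cut-off interpolation reduces this to a compactly supported perturbation, which changes the pullback
by an exact form (`integral_pullback_add_sub_eq_zero`, `setIntegral_pullback_eq`). If `|{F', G'}| ≤
c` held on the chart, this integral would be at most `c ∫ α(F) β(G) |Ω|` up to a small error,
whereas for `(F, G)` it exceeds that by a fixed amount (`exists_lt_abs_jacobianPair`). -/

open MeasureTheory Set Metric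

/-! ### Integrals of pulled-back area forms and their invariance. -/

section Jacobian

variable {E : Type*} [NormedAddCommGroup E] [NormedSpace ℝ E]

/-- The value of `dF ∧ dG` on the pair of vectors `(v, w)` at the point `y`. -/
noncomputable def jacobianPair (v w : E) (F G : E → ℝ) (y : E) : ℝ :=
  fderiv ℝ F y v * fderiv ℝ G y w - fderiv ℝ F y w * fderiv ℝ G y v

theorem continuous_jacobianPair (v w : E) {F G : E → ℝ} (hF : ContDiff ℝ ∞ F)
    (hG : ContDiff ℝ ∞ G) : Continuous (jacobianPair v w F G) := by
  have h1 := hF.continuous_fderiv (by simp)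
  have h2 := hG.continuous_fderiv (by simp)
  unfold jacobianPair
  fun_prop

theorem jacobianPair_congr (v w : E) {F G F' G' : E → ℝ} {y : E} (hF : F =ᶠ[𝓝 y] F')
    (hG : G =ᶠ[𝓝 y] G') : jacobianPair v w F G y = jacobianPair v w F' G' y := by
  simp only [jacobianPair, hF.fderiv_eq, hG.fderiv_eq]

theorem jacobianPair_swap (v w : E) (F G : E → ℝ) (y : E) :
    jacobianPair v w F G y = -jacobianPair v w G F y := by
  simp only [jacobianPair]; ring

theorem jacobianPair_add_left (v w : E) {F f G : E → ℝ} {y : E} (hF : DifferentiableAt ℝ F y)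
    (hf : DifferentiableAt ℝ f y) :
    jacobianPair v w (F + f) G y = jacobianPair v w F G y + jacobianPair v w f G y := by
  simp only [jacobianPair, fderiv_add hF hf, add_apply]; ring

theorem jacobianPair_add_right (v w : E) {F G g : E → ℝ} {y : E} (hG : DifferentiableAt ℝ G y)
    (hg : DifferentiableAt ℝ g y) :
    jacobianPair v w F (G + g) y = jacobianPair v w F G y + jacobianPair v w F g y := by
  simp only [jacobianPair, fderiv_add hG hg, add_apply]; ring

theorem jacobianPair_comp (v w : E) {F G : E → ℝ} {A B : ℝ → ℝ} {a b : ℝ} {y : E}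
    (hF : DifferentiableAt ℝ F y) (hG : DifferentiableAt ℝ G y)
    (hA : HasDerivAt A a (F y)) (hB : HasDerivAt B b (G y)) :
    jacobianPair v w (A ∘ F) (B ∘ G) y = a * b * jacobianPair v w F G y := by
  simp only [jacobianPair, (hA.comp_hasFDerivAt y hF.hasFDerivAt).fderiv,
    (hB.comp_hasFDerivAt y hG.hasFDerivAt).fderiv, smul_apply, smul_eq_mul]
  ring

variable [FiniteDimensional ℝ E] [MeasurableSpace E] [BorelSpace E] {μ : Measure E}
  [μ.IsAddHaarMeasure]

/-- Integration by parts of `da ∧ dB = d(a dB)` for a compactly supported function `a`. -/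
theorem integral_jacobianPair_eq_zero (v w : E) {a B : E → ℝ} (ha : ContDiff ℝ ∞ a)
    (hac : HasCompactSupport a) (hB : ContDiff ℝ ∞ B) : ∫ y, jacobianPair v w a B y ∂μ = 0 := by
  have hBv : ∀ v : E, ContDiff ℝ ∞ (fun y => fderiv ℝ B y v) := fun v =>
    (hB.fderiv_right (m := ∞) (by simp)).clm_apply contDiff_const
  have hda : ∀ v : E, Continuous (fun y => fderiv ℝ a y v) := fun v =>
    (ha.continuous_fderiv (by simp)).clm_apply continuous_const
  have hdc : ∀ v : E, HasCompactSupport (fun y => fderiv ℝ a y v) := fun v => hac.fderiv_apply ℝ v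
  have hI : ∀ v w : E, Integrable (fun y => fderiv ℝ a y v * fderiv ℝ B y w) μ := fun v w =>
    ((hda v).mul (hBv w).continuous).integrable_of_hasCompactSupport (hdc v).mul_right
  have key : ∀ v w : E, ∫ y, a y * fderiv ℝ (fun y => fderiv ℝ B y w) y v ∂μ =
      -∫ y, fderiv ℝ a y v * fderiv ℝ B y w ∂μ := fun v w =>
    integral_mul_fderiv_eq_neg_fderiv_mul_of_integrable (hI v w)
      ((ha.continuous.mul (((hBv w).continuous_fderiv (by simp)).clm_apply
        continuous_const)).integrable_of_hasCompactSupport hac.mul_right)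
      ((ha.continuous.mul (hBv w).continuous).integrable_of_hasCompactSupport hac.mul_right)
      (fun y _ => ha.differentiable (by simp) y) (fun y _ => (hBv w).differentiable (by simp) y)
  -- This is `d(dB) = 0`: the second-order terms left by the two integrations by parts cancel.
  have hsymm : ∀ y, fderiv ℝ (fun y => fderiv ℝ B y w) y v =
      fderiv ℝ (fun y => fderiv ℝ B y v) y w := fun y => by
    have hd : DifferentiableAt ℝ (fderiv ℝ B) y :=
      (hB.fderiv_right (m := ∞) (by simp)).differentiable (by simp) y
    have hs : IsSymmSndFDerivAt ℝ B y := hB.contDiffAt.isSymmSndFDerivAt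
      (by simpa using WithTop.coe_le_coe.2 (le_top : (2 : ℕ∞) ≤ ⊤))
    rw [fderiv_clm_apply hd (differentiableAt_const _),
      fderiv_clm_apply hd (differentiableAt_const _)]
    simpa using hs.eq v w
  have h1 := key v w
  have h2 := key w v
  simp only [hsymm] at h1
  simp only [jacobianPair]
  rw [integral_sub (hI v w) (hI w v)]
  linarith

/-- The integrand is `df ∧ d(G + g) - dg ∧ dF`, and each term has a compactly supported first
factor. -/
theorem integral_jacobianPair_add_sub_eq_zero (v w : E) {F G f g : E → ℝ} (hF : ContDiff ℝ ∞ F)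
    (hG : ContDiff ℝ ∞ G) (hf : ContDiff ℝ ∞ f) (hg : ContDiff ℝ ∞ g) (hfc : HasCompactSupport f)
    (hgc : HasCompactSupport g) :
    ∫ y, (jacobianPair v w (F + f) (G + g) y - jacobianPair v w F G y) ∂μ = 0 := by
  have e : ∀ y, jacobianPair v w (F + f) (G + g) y - jacobianPair v w F G y =
      jacobianPair v w f (G + g) y - jacobianPair v w g F y := fun y => by
    rw [jacobianPair_add_left v w (hF.differentiable (by simp) y) (hf.differentiable (by simp) y),
      jacobianPair_add_right v w (F := F) (hG.differentiable (by simp) y)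
        (hg.differentiable (by simp) y), jacobianPair_swap v w g F]
    ring
  have hi : ∀ {a B : E → ℝ}, ContDiff ℝ ∞ a → HasCompactSupport a → ContDiff ℝ ∞ B →
      Integrable (jacobianPair v w a B) μ := fun {a B} ha hac hB => by
    refine (continuous_jacobianPair v w ha hB).integrable_of_hasCompactSupport ?_
    exact ((hac.fderiv_apply ℝ v).mul_right).sub ((hac.fderiv_apply ℝ w).mul_right)
  have hGg : ContDiff ℝ ∞ (G + g) := hG.add hg
  simp only [e]
  rw [integral_sub (hi hf hfc hGg) (hi hg hgc hF), integral_jacobianPair_eq_zero v w hf hfc hGg,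
    integral_jacobianPair_eq_zero v w hg hgc hF, sub_zero]

/-- Primitives absorb the weights: `α(F) dF ∧ β(G) dG = d(A ∘ F) ∧ d(B ∘ G)`. -/
theorem exists_contDiff_primitive {α : ℝ → ℝ} (hα : ContDiff ℝ ∞ α) :
    ∃ A : ℝ → ℝ, ContDiff ℝ ∞ A ∧ ∀ x, HasDerivAt A (α x) x := by
  have h : ∀ x, HasDerivAt (fun x => ∫ t in (0 : ℝ)..x, α t) (α x) x := fun x =>
    hα.continuous.integral_hasStrictDerivAt 0 x |>.hasDerivAt
  refine ⟨_, contDiff_infty_iff_deriv.2 ⟨fun x => (h x).differentiableAt, ?_⟩, h⟩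
  rwa [show deriv (fun x => ∫ t in (0 : ℝ)..x, α t) = α from funext fun x => (h x).deriv]

/-- Invariance of `∫ (F, G)^* (α(s) β(t) ds ∧ dt)` under compactly supported perturbations. -/
theorem integral_pullback_add_sub_eq_zero (v w : E) {F G f g : E → ℝ} {α β : ℝ → ℝ}
    (hF : ContDiff ℝ ∞ F) (hG : ContDiff ℝ ∞ G) (hf : ContDiff ℝ ∞ f) (hg : ContDiff ℝ ∞ g)
    (hfc : HasCompactSupport f) (hgc : HasCompactSupport g) (hα : ContDiff ℝ ∞ α)
    (hβ : ContDiff ℝ ∞ β) :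
    ∫ y, (α ((F + f) y) * β ((G + g) y) * jacobianPair v w (F + f) (G + g) y -
      α (F y) * β (G y) * jacobianPair v w F G y) ∂μ = 0 := by
  obtain ⟨A, hA, hA'⟩ := exists_contDiff_primitive hα
  obtain ⟨B, hB, hB'⟩ := exists_contDiff_primitive hβ
  have hc : ∀ {C : ℝ → ℝ} {H h : E → ℝ}, HasCompactSupport h →
      HasCompactSupport (C ∘ (H + h) - C ∘ H) := fun {C H h} hh =>
    hh.mono fun y hy => by
      contrapose! hy
      simp only [Function.mem_support, not_not] at hy ⊢
      simp [hy]
  have := integral_jacobianPair_add_sub_eq_zero (μ := μ) (f := A ∘ (F + f) - A ∘ F)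
    (g := B ∘ (G + g) - B ∘ G) v w (hA.comp hF) (hB.comp hG)
    ((hA.comp (hF.add hf)).sub (hA.comp hF)) ((hB.comp (hG.add hg)).sub (hB.comp hG))
    (hc (C := A) (H := F) hfc) (hc (C := B) (H := G) hgc)
  rw [← this]
  refine integral_congr_ae (.of_forall fun y => ?_)
  dsimp only
  rw [jacobianPair_comp v w (hF.differentiable (by simp) y) (hG.differentiable (by simp) y)
    (hA' _) (hB' _)]
  have e1 : A ∘ F + (A ∘ (F + f) - A ∘ F) = A ∘ (F + f) := by abel
  have e2 : B ∘ G + (B ∘ (G + g) - B ∘ G) = B ∘ (G + g) := by abel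
  have hFf : ContDiff ℝ ∞ (F + f) := hF.add hf
  have hGg : ContDiff ℝ ∞ (G + g) := hG.add hg
  rw [e1, e2, jacobianPair_comp v w (hFf.differentiable (by simp) y)
    (hGg.differentiable (by simp) y) (hA' _) (hB' _)]

theorem integrableOn_ball_of_continuous {f : E → ℝ} (hf : Continuous f) (y : E) (r : ℝ) :
    IntegrableOn f (ball y r) μ :=
  (hf.continuousOn.integrableOn_compact (isCompact_closedBall y r)).mono_set ball_subset_closedBall

/-- Two maps `(F, G)` and `(F', G')` that are close on a ball give the same integral of a pulled
back area form, if both send the outer part of the ball away from the support of that form. -/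
theorem setIntegral_pullback_eq (v w : E) {F G F' G' : E → ℝ} {α β : ℝ → ℝ}
    (hF : ContDiff ℝ ∞ F) (hG : ContDiff ℝ ∞ G) (hF' : ContDiff ℝ ∞ F') (hG' : ContDiff ℝ ∞ G')
    (hα : ContDiff ℝ ∞ α) (hβ : ContDiff ℝ ∞ β) {y₀ : E} {r R δ : ℝ} (hr : 0 < r) (hrR : r < R)
    (hsep : ∀ y ∈ ball y₀ R, r ≤ dist y y₀ → 2 * δ ≤ |F y - F y₀| ∨ 2 * δ ≤ |G y - G y₀|)
    (hα0 : ∀ x, δ ≤ |x - F y₀| → α x = 0) (hβ0 : ∀ x, δ ≤ |x - G y₀| → β x = 0)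
    (hFF : ∀ y ∈ ball y₀ R, |F y - F' y| ≤ δ) (hGG : ∀ y ∈ ball y₀ R, |G y - G' y| ≤ δ) :
    ∫ y in ball y₀ r, α (F' y) * β (G' y) * jacobianPair v w F' G' y ∂μ =
      ∫ y in ball y₀ r, α (F y) * β (G y) * jacobianPair v w F G y ∂μ := by
  let χ : ContDiffBump y₀ := ⟨r, R, hr, hrR⟩
  have hχ : ContDiff ℝ ∞ χ := χ.contDiff
  -- The interpolation equals `(F', G')` on the inner ball and `(F, G)` outside the outer one.
  have key := integral_pullback_add_sub_eq_zero (μ := μ) (f := (χ : E → ℝ) * (F' - F)) (g := (χ : E → ℝ) * (G' - G))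
    v w hF hG (hχ.mul (hF'.sub hF)) (hχ.mul (hG'.sub hG)) χ.hasCompactSupport.mul_right
    χ.hasCompactSupport.mul_right hα hβ
  have hin : ∀ H H' : E → ℝ, ∀ y ∈ ball y₀ r, H + (χ : E → ℝ) * (H' - H) =ᶠ[𝓝 y] H' := fun H H' y hy => by
    filter_upwards [χ.eventuallyEq_one_of_mem_ball hy] with x hx
    simp [hx]
  -- On the annulus the whole segment from `(F, G)` to `(F', G')` misses the support of the form; `s
  -- = χ y` and `s = 0` are the cases needed.
  have hzero : ∀ s ∈ Icc (0 : ℝ) 1, ∀ y ∈ ball y₀ R, r ≤ dist y y₀ →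
      α (F y + s * (F' y - F y)) * β (G y + s * (G' y - G y)) = 0 := by
    intro s hs y hyR hyr
    have aux : ∀ H H' : E → ℝ, |H y - H' y| ≤ δ → 2 * δ ≤ |H y - H y₀| →
        δ ≤ |H y + s * (H' y - H y) - H y₀| := fun H H' h1 h2 => by
      have h3 : |s * (H' y - H y)| ≤ δ := by
        rw [abs_mul, abs_of_nonneg hs.1, abs_sub_comm]
        nlinarith [abs_nonneg (H y - H' y), hs.1, hs.2]
      have h4 := abs_sub_abs_le_abs_sub (H y - H y₀) (-(s * (H' y - H y)))
      rw [abs_neg, show H y - H y₀ - -(s * (H' y - H y)) = H y + s * (H' y - H y) - H y₀ by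
        ring] at h4
      linarith
    rcases hsep y hyR hyr with h | h
    · rw [hα0 _ (aux F F' (hFF y hyR) h), zero_mul]
    · rw [hβ0 _ (aux G G' (hGG y hyR) h), mul_zero]
  have e : (fun y => α ((F + (χ : E → ℝ) * (F' - F)) y) * β ((G + (χ : E → ℝ) * (G' - G)) y) *
        jacobianPair v w (F + (χ : E → ℝ) * (F' - F)) (G + (χ : E → ℝ) * (G' - G)) y -
        α (F y) * β (G y) * jacobianPair v w F G y) =
      (ball y₀ r).indicator (fun y => α (F' y) * β (G' y) * jacobianPair v w F' G' y -
        α (F y) * β (G y) * jacobianPair v w F G y) := by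
    funext y
    by_cases hy : y ∈ ball y₀ r
    · rw [indicator_of_mem hy, (hin F F' y hy).eq_of_nhds, (hin G G' y hy).eq_of_nhds,
        jacobianPair_congr v w (hin F F' y hy) (hin G G' y hy)]
    · rw [indicator_of_notMem hy]
      rw [mem_ball, not_lt] at hy
      by_cases hyR : y ∈ ball y₀ R
      · have h1 := hzero (χ y) ⟨χ.nonneg, χ.le_one⟩ y hyR hy
        have h2 := hzero 0 (by simp) y hyR hy
        simp only [zero_mul, add_zero] at h2
        simp only [Pi.add_apply, Pi.mul_apply, Pi.sub_apply, h1, h2, zero_mul, sub_zero]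
      · have hout : ∀ H H' : E → ℝ, (H + (χ : E → ℝ) * (H' - H)) y = H y := fun H H' => by
          simp [χ.zero_of_le_dist (not_lt.1 hyR)]
        have hd : ∀ {H H' : E → ℝ}, ContDiff ℝ ∞ H → ContDiff ℝ ∞ H' →
            fderiv ℝ (H + (χ : E → ℝ) * (H' - H)) y = fderiv ℝ H y := fun {H H'} hH hH' => by
          -- On the bounding sphere `χ` need not vanish nearby, but its zeros are minima, so its
          -- derivative vanishes too.
          have hm : IsLocalMin χ y := .of_forall fun x => by
            rw [χ.zero_of_le_dist (not_lt.1 hyR)]; exact χ.nonneg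
          have hχd : DifferentiableAt ℝ χ y := hχ.differentiable (by simp) y
          have hsd : DifferentiableAt ℝ (H' - H) y := (hH'.sub hH).differentiable (by simp) y
          rw [fderiv_add (hH.differentiable (by simp) y) (hχd.mul hsd), fderiv_mul hχd hsd,
            hm.fderiv_eq_zero, χ.zero_of_le_dist (not_lt.1 hyR)]
          simp
        simp only [hout, jacobianPair, hd hF hF', hd hG hG', sub_self]
  have hi : ∀ {H K : E → ℝ}, ContDiff ℝ ∞ H → ContDiff ℝ ∞ K →
      IntegrableOn (fun y => α (H y) * β (K y) * jacobianPair v w H K y) (ball y₀ r) μ :=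
    fun hH hK => integrableOn_ball_of_continuous
      (((hα.continuous.comp hH.continuous).mul (hβ.continuous.comp hK.continuous)).mul
        (continuous_jacobianPair v w hH hK)) _ _
  rw [e, integral_indicator measurableSet_ball, integral_sub (hi hF' hG') (hi hF hG)] at key
  linarith

end Jacobian

/-! ### Persistence of a lower bound on the Jacobian. -/

section JacobianBound

variable {E : Type*} [NormedAddCommGroup E] [NormedSpace ℝ E]

theorem contDiff_mul_of_tsupport_subset {n : WithTop ℕ∞} {χ f : E → ℝ} {U : Set E} (hU : IsOpen U)
    (hχ : ContDiff ℝ n χ) (hf : ContDiffOn ℝ n f U) (hs : tsupport χ ⊆ U) :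
    ContDiff ℝ n fun y => χ y * f y := by
  refine contDiff_iff_contDiffAt.2 fun y => ?_
  by_cases hy : y ∈ tsupport χ
  · exact hχ.contDiffAt.mul (hf.contDiffAt (hU.mem_nhds (hs hy)))
  · refine (contDiffAt_const (c := (0 : ℝ))).congr_of_eventuallyEq ?_
    filter_upwards [(isClosed_tsupport χ).isOpen_compl.mem_nhds hy] with x hx
    rw [image_eq_zero_of_notMem_tsupport hx, zero_mul]

variable [FiniteDimensional ℝ E]

/-- By Cramer's rule the differential of `(F, G)` is injective, hence bounded below. -/
theorem eventually_ne_of_jacobianPair_ne_zero {v w : E} (hvw : ∀ u : E, ∃ a b : ℝ, u = a • v + b • w)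
    {F G : E → ℝ} {y₀ : E} (hF : DifferentiableAt ℝ F y₀) (hG : DifferentiableAt ℝ G y₀)
    (hJ : jacobianPair v w F G y₀ ≠ 0) :
    ∀ᶠ y in 𝓝[≠] y₀, (F y, G y) ≠ (F y₀, G y₀) := by
  refine (hF.hasFDerivAt.prodMk hG.hasFDerivAt).eventually_ne ?_
  have hker : LinearMap.ker
      (((fderiv ℝ F y₀).prod (fderiv ℝ G y₀) : E →L[ℝ] ℝ × ℝ) : E →ₗ[ℝ] ℝ × ℝ) = ⊥ := by
    refine LinearMap.ker_eq_bot'.2 fun u hu => ?_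
    obtain ⟨a, b, rfl⟩ := hvw u
    have h : fderiv ℝ F y₀ (a • v + b • w) = 0 ∧ fderiv ℝ G y₀ (a • v + b • w) = 0 := by
      simpa [Prod.ext_iff] using hu
    simp only [map_add, map_smul, smul_eq_mul] at h
    unfold jacobianPair at hJ
    have ha : a = 0 := (mul_eq_zero.1 (show a * (fderiv ℝ F y₀ v * fderiv ℝ G y₀ w -
      fderiv ℝ F y₀ w * fderiv ℝ G y₀ v) = 0 by
        linear_combination fderiv ℝ G y₀ w * h.1 - fderiv ℝ F y₀ w * h.2)).resolve_right hJ
    have hb : b = 0 := (mul_eq_zero.1 (show b * (fderiv ℝ F y₀ v * fderiv ℝ G y₀ w -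
      fderiv ℝ F y₀ w * fderiv ℝ G y₀ v) = 0 by
        linear_combination fderiv ℝ F y₀ v * h.2 - fderiv ℝ G y₀ v * h.1)).resolve_right hJ
    simp [ha, hb]
  obtain ⟨K, -, hK⟩ := LinearMap.exists_antilipschitzWith _ hker
  exact ⟨K, hK⟩

theorem exists_lt_abs_jacobianPair {v w : E} (hvw : ∀ u : E, ∃ a b : ℝ, u = a • v + b • w)
    {F G ρ : E → ℝ} (hF : ContDiff ℝ ∞ F) (hG : ContDiff ℝ ∞ G) (hρ : Continuous ρ)
    (hρ0 : ∀ y, 0 ≤ ρ y) {y₀ : E} {c R₀ : ℝ} (hc : 0 ≤ c) (hR₀ : 0 < R₀)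
    (hJ : c * ρ y₀ < |jacobianPair v w F G y₀|) :
    ∃ ε > 0, ∀ F' G' : E → ℝ, ContDiff ℝ ∞ F' → ContDiff ℝ ∞ G' →
      (∀ y ∈ ball y₀ R₀, |F y - F' y| < ε) → (∀ y ∈ ball y₀ R₀, |G y - G' y| < ε) →
      ∃ y ∈ ball y₀ R₀, c * ρ y < |jacobianPair v w F' G' y| := by
  borelize E
  let μ : Measure E := Measure.addHaar
  have hJc := continuous_jacobianPair v w hF hG
  have hJ0 : jacobianPair v w F G y₀ ≠ 0 := abs_pos.1 ((mul_nonneg hc (hρ0 y₀)).trans_lt hJ)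
  obtain ⟨s, hs, hsJ⟩ : ∃ s : ℝ, |s| = 1 ∧ s * jacobianPair v w F G y₀ =
      |jacobianPair v w F G y₀| := by
    rcases abs_choice (jacobianPair v w F G y₀) with h | h
    · exact ⟨1, by simp, by rw [h, one_mul]⟩
    · exact ⟨-1, by simp, by rw [h]; ring⟩
  have hDc : Continuous fun y => s * jacobianPair v w F G y - c * ρ y := by fun_prop
  have hD0 : ∀ᶠ y in 𝓝 y₀, 0 < s * jacobianPair v w F G y - c * ρ y :=
    hDc.continuousAt.eventually (lt_mem_nhds (by simp only [hsJ]; linarith))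
  have hne := eventually_nhdsWithin_iff.1 (eventually_ne_of_jacobianPair_ne_zero hvw
    (hF.differentiable (by simp) y₀) (hG.differentiable (by simp) y₀) hJ0)
  obtain ⟨R, hR, hRsub⟩ := nhds_basis_closedBall.mem_iff.1
    ((hD0.and hne).and (ball_mem_nhds y₀ hR₀))
  have hRR₀ : ball y₀ R ⊆ ball y₀ R₀ := fun y hy => (hRsub (ball_subset_closedBall hy)).2
  obtain ⟨δ₀, hδ₀, hsep⟩ := ((isCompact_closedBall y₀ R).diff (isOpen_ball (x := y₀)
    (ε := R / 2))).exists_forall_le' (f := fun y => max |F y - F y₀| |G y - G y₀|) (a := 0)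
    (((hF.continuous.sub continuous_const).abs.max
      (hG.continuous.sub continuous_const).abs).continuousOn) (by
      rintro y ⟨hy, hyr⟩
      have hyne : y ≠ y₀ := by
        rintro rfl; exact hyr (mem_ball_self (half_pos hR))
      have := (hRsub hy).1.2 hyne
      by_contra! hle
      obtain ⟨h1, h2⟩ := max_le_iff.1 hle
      exact this (Prod.ext (sub_eq_zero.1 (abs_nonpos_iff.1 h1))
        (sub_eq_zero.1 (abs_nonpos_iff.1 h2))))
  -- Outer radius `δ₀ / 2`: a value at distance `δ₀` from the centre may move by `δ₀ / 2` and still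
  -- avoid the support.
  let α : ContDiffBump (F y₀) := ⟨δ₀ / 4, δ₀ / 2, by linarith, by linarith⟩
  let β : ContDiffBump (G y₀) := ⟨δ₀ / 4, δ₀ / 2, by linarith, by linarith⟩
  have hα : ContDiff ℝ ∞ α := α.contDiff
  have hβ : ContDiff ℝ ∞ β := β.contDiff
  have hP : Continuous fun y => α (F y) * β (G y) :=
    (hα.continuous.comp hF.continuous).mul (hβ.continuous.comp hG.continuous)
  have hI : 0 < ∫ y in ball y₀ (R / 2), α (F y) * β (G y) *
      (s * jacobianPair v w F G y - c * ρ y) ∂μ := by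
    rw [setIntegral_pos_iff_support_of_nonneg_ae]
    · refine IsOpen.measure_pos μ (((hP.mul hDc).isOpen_support).inter isOpen_ball)
        ⟨y₀, ?_, mem_ball_self (half_pos hR)⟩
      exact (mul_pos (mul_pos (α.pos_of_mem_ball (mem_ball_self α.rOut_pos))
        (β.pos_of_mem_ball (mem_ball_self β.rOut_pos))) hD0.self_of_nhds).ne'
    · refine (ae_restrict_iff' measurableSet_ball).2 (.of_forall fun y hy => ?_)
      exact mul_nonneg (mul_nonneg α.nonneg β.nonneg)
        (hRsub (ball_subset_closedBall (ball_subset_ball (by linarith) hy))).1.1.le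
    · exact integrableOn_ball_of_continuous (hP.mul hDc) _ _
  set I := ∫ y in ball y₀ (R / 2), α (F y) * β (G y) *
      (s * jacobianPair v w F G y - c * ρ y) ∂μ with hIdef
  set W := ∫ y in ball y₀ (R / 2), ρ y ∂μ with hWdef
  have hW : 0 ≤ W := setIntegral_nonneg measurableSet_ball fun y _ => hρ0 y
  have hcW := mul_nonneg hc hW
  -- If each bump factor changes by less than `η`, the product, with factors in `[0, 1]`, changes by
  -- at most `2 * η`; `η` keeps the resulting error below the gap `I`.
  obtain ⟨η, hη, hηI⟩ : ∃ η > 0, 2 * η * (c * W) < I := by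
    refine ⟨I / (2 * (c * W) + 1), by positivity, ?_⟩
    rw [show 2 * (I / (2 * (c * W) + 1)) * (c * W) = I * (2 * (c * W)) / (2 * (c * W) + 1) by ring,
      div_lt_iff₀ (by positivity)]
    linarith
  obtain ⟨ε₁, hε₁, hαε⟩ := Metric.uniformContinuous_iff.1
    (α.hasCompactSupport.uniformContinuous_of_continuous hα.continuous) η hη
  obtain ⟨ε₂, hε₂, hβε⟩ := Metric.uniformContinuous_iff.1
    (β.hasCompactSupport.uniformContinuous_of_continuous hβ.continuous) η hη
  refine ⟨min (min ε₁ ε₂) (δ₀ / 2), by positivity, fun F' G' hF' hG' hFF hGG => ?_⟩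
  simp only [lt_min_iff] at hFF hGG
  by_contra! hle
  have heq := setIntegral_pullback_eq (μ := μ) v w hF hG hF' hG' hα hβ (half_pos hR)
    (half_lt_self hR) (δ := δ₀ / 2)
    (fun y hy hyr => by
      rw [mul_div_cancel₀ _ two_ne_zero]
      exact le_max_iff.1 (hsep y ⟨ball_subset_closedBall hy, by simpa using hyr⟩))
    (fun x hx => α.zero_of_le_dist hx) (fun x hx => β.zero_of_le_dist hx)
    (fun y hy => (hFF y (hRR₀ hy)).2.le) (fun y hy => (hGG y (hRR₀ hy)).2.le)
  have hmono : ∫ y in ball y₀ (R / 2), s * (α (F' y) * β (G' y) * jacobianPair v w F' G' y) ∂μ ≤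
      ∫ y in ball y₀ (R / 2), (α (F y) * β (G y) * (c * ρ y) + 2 * η * (c * ρ y)) ∂μ := by
    refine setIntegral_mono_on (integrableOn_ball_of_continuous ?_ _ _)
      (integrableOn_ball_of_continuous ?_ _ _) measurableSet_ball fun y hy => ?_
    · exact continuous_const.mul (((hα.continuous.comp hF'.continuous).mul
        (hβ.continuous.comp hG'.continuous)).mul (continuous_jacobianPair v w hF' hG'))
    · exact (hP.mul (continuous_const.mul hρ)).add (continuous_const.mul (continuous_const.mul hρ))
    · have hyR : y ∈ ball y₀ R₀ := hRR₀ (ball_subset_ball (by linarith) hy)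
      have h1 := hαε (hFF y hyR).1.1
      have h2 := hβε (hGG y hyR).1.2
      rw [Real.dist_eq] at h1 h2
      have h3 : α (F' y) * β (G' y) ≤ α (F y) * β (G y) + 2 * η := by
        have := α.nonneg' (F' y)
        have := α.le_one (x := F' y)
        have := β.nonneg' (G y)
        have := β.le_one (x := G y)
        rw [abs_lt] at h1 h2
        nlinarith
      have h4 : s * jacobianPair v w F' G' y ≤ c * ρ y := by
        refine (le_abs_self _).trans ?_
        rw [abs_mul, hs, one_mul]
        exact hle y hyR
      calc s * (α (F' y) * β (G' y) * jacobianPair v w F' G' y)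
          = α (F' y) * β (G' y) * (s * jacobianPair v w F' G' y) := by ring
        _ ≤ α (F' y) * β (G' y) * (c * ρ y) :=
          mul_le_mul_of_nonneg_left h4 (mul_nonneg α.nonneg β.nonneg)
        _ ≤ (α (F y) * β (G y) + 2 * η) * (c * ρ y) :=
          mul_le_mul_of_nonneg_right h3 (mul_nonneg hc (hρ0 y))
        _ = _ := by ring
  have hsplit : I = s * (∫ y in ball y₀ (R / 2), α (F y) * β (G y) * jacobianPair v w F G y ∂μ) -
      ∫ y in ball y₀ (R / 2), α (F y) * β (G y) * (c * ρ y) ∂μ := by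
    rw [hIdef, ← integral_const_mul, ← integral_sub]
    · congr 1; funext y; ring
    · exact integrableOn_ball_of_continuous (continuous_const.mul (hP.mul hJc)) _ _
    · exact integrableOn_ball_of_continuous (hP.mul (continuous_const.mul hρ)) _ _
  rw [integral_const_mul, heq, integral_add, integral_const_mul, integral_const_mul] at hmono
  · linarith
  · exact integrableOn_ball_of_continuous (hP.mul (continuous_const.mul hρ)) _ _
  · exact integrableOn_ball_of_continuous (continuous_const.mul (continuous_const.mul hρ)) _ _

/-- A lower bound for the Jacobian of `(F, G)` relative to a density at a point persists, at some
nearby point, under uniformly small smooth perturbations of `(F, G)`. -/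
theorem exists_lt_abs_jacobianPair_on {v w : E} (hvw : ∀ u : E, ∃ a b : ℝ, u = a • v + b • w)
    {U : Set E} (hU : IsOpen U) {F G ρ : E → ℝ} (hF : ContDiffOn ℝ ∞ F U)
    (hG : ContDiffOn ℝ ∞ G U) (hρ : ContinuousOn ρ U) (hρ0 : ∀ y, 0 ≤ ρ y) {y₀ : E} (hy₀ : y₀ ∈ U)
    {c : ℝ} (hc : 0 ≤ c) (hJ : c * ρ y₀ < |jacobianPair v w F G y₀|) :
    ∃ ε > 0, ∀ F' G' : E → ℝ, ContDiffOn ℝ ∞ F' U → ContDiffOn ℝ ∞ G' U →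
      (∀ y ∈ U, |F y - F' y| < ε) → (∀ y ∈ U, |G y - G' y| < ε) →
      ∃ y ∈ U, c * ρ y < |jacobianPair v w F' G' y| := by
  obtain ⟨R, hR, hRU⟩ := nhds_basis_closedBall.mem_iff.1 (hU.mem_nhds hy₀)
  -- Multiplying all functions by `χ` makes them global without changing them on the half-radius
  -- ball.
  let χ : ContDiffBump y₀ := ⟨R / 2, R, half_pos hR, half_lt_self hR⟩
  have hχ : ContDiff ℝ ∞ χ := χ.contDiff
  have hs : tsupport χ ⊆ U := by rw [χ.tsupport_eq]; exact hRU
  have hball : ball y₀ (R / 2) ⊆ U := fun y hy =>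
    hRU (ball_subset_closedBall (ball_subset_ball (half_le_self hR.le) hy))
  have hev : ∀ H : E → ℝ, ∀ y ∈ ball y₀ (R / 2), (fun x => χ x * H x) =ᶠ[𝓝 y] H := fun H y hy => by
    filter_upwards [χ.eventuallyEq_one_of_mem_ball hy] with x hx
    rw [hx, Pi.one_apply, one_mul]
  have hcut : ∀ {H : E → ℝ}, ContDiffOn ℝ ∞ H U → ContDiff ℝ ∞ fun y => χ y * H y := fun hH =>
    contDiff_mul_of_tsupport_subset hU hχ hH hs
  have hy₀' : y₀ ∈ ball y₀ (R / 2) := mem_ball_self (half_pos hR)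
  obtain ⟨ε, hε, h⟩ := exists_lt_abs_jacobianPair hvw (hcut hF) (hcut hG)
    (ρ := fun y => χ y * ρ y) (y₀ := y₀)
    (contDiff_zero.1 (contDiff_mul_of_tsupport_subset hU (contDiff_zero.2 hχ.continuous)
      (contDiffOn_zero.2 hρ) hs))
    (fun y => mul_nonneg χ.nonneg (hρ0 y)) hc (half_pos hR) (by
      rwa [jacobianPair_congr v w (hev F y₀ hy₀') (hev G y₀ hy₀'), (hev ρ y₀ hy₀').eq_of_nhds])
  refine ⟨ε, hε, fun F' G' hF' hG' hFF hGG => ?_⟩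
  obtain ⟨y, hy, hlt⟩ := h _ _ (hcut hF') (hcut hG')
    (fun y hy => by
      rw [(hev F y hy).eq_of_nhds, (hev F' y hy).eq_of_nhds]; exact hFF y (hball hy))
    (fun y hy => by
      rw [(hev G y hy).eq_of_nhds, (hev G' y hy).eq_of_nhds]; exact hGG y (hball hy))
  rw [jacobianPair_congr v w (hev F' y hy) (hev G' y hy), (hev ρ y hy).eq_of_nhds] at hlt
  exact ⟨y, hball hy, hlt⟩

end JacobianBound

theorem abs_lt_of_supNorm_lt {X : Type*} {f : X → ℝ} {ε : ℝ} (h : supNorm f < ENNReal.ofReal ε)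
    (x : X) : |f x| < ε := by
  have := (le_iSup (fun x => ‖f x‖ₑ) x).trans_lt h
  rw [Real.enorm_eq_ofReal_abs] at this
  exact (ENNReal.ofReal_lt_ofReal_iff_of_nonneg (abs_nonneg _)).1 this

/-! ### Transfer to the symplectic surface through a chart. -/

section Surface

variable {M : Type*} [TopologicalSpace M] [ChartedSpace (EuclideanSpace ℝ (Fin 2)) M]

theorem euclideanSpace_fin_two_decomp (u : EuclideanSpace ℝ (Fin 2)) : ∃ a b : ℝ,
    u = a • EuclideanSpace.single (0 : Fin 2) (1 : ℝ) +
      b • EuclideanSpace.single (1 : Fin 2) (1 : ℝ) := by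
  refine ⟨u 0, u 1, ?_⟩
  ext i
  fin_cases i <;> simp

/-- The coefficient of the symplectic form in the coordinates of the chart at `z₀`. -/
noncomputable def SymplecticForm.coefficient (Ω : SymplecticForm 2 M) (z₀ : M)
    (y : EuclideanSpace ℝ (Fin 2)) : ℝ :=
  formInChart Ω.form z₀ y
    ![EuclideanSpace.single (0 : Fin 2) (1 : ℝ), EuclideanSpace.single (1 : Fin 2) (1 : ℝ)]

theorem SymplecticForm.continuousOn_coefficient (Ω : SymplecticForm 2 M) (z₀ : M) :
    ContinuousOn (Ω.coefficient z₀) (extChartAt (𝓡 2) z₀).target :=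
  (continuous_eval_const (F := EuclideanSpace ℝ (Fin 2) [⋀^Fin 2]→L[ℝ] ℝ)
    ![EuclideanSpace.single (0 : Fin 2) (1 : ℝ),
      EuclideanSpace.single (1 : Fin 2) (1 : ℝ)]).comp_continuousOn (Ω.smooth z₀).continuousOn

theorem SymplecticForm.coefficient_eq (Ω : SymplecticForm 2 M) (z₀ : M)
    (y : EuclideanSpace ℝ (Fin 2)) :
    Ω.coefficient z₀ y = Ω.form ((extChartAt (𝓡 2) z₀).symm y)
      ![mfderiv 𝓘(ℝ, EuclideanSpace ℝ (Fin 2)) (𝓡 2) (extChartAt (𝓡 2) z₀).symm y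
          (EuclideanSpace.single (0 : Fin 2) (1 : ℝ)),
        mfderiv 𝓘(ℝ, EuclideanSpace ℝ (Fin 2)) (𝓡 2) (extChartAt (𝓡 2) z₀).symm y
          (EuclideanSpace.single (1 : Fin 2) (1 : ℝ))] := by
  refine congrArg (Ω.form ((extChartAt (𝓡 2) z₀).symm y)) (funext fun i => ?_)
  fin_cases i <;> rfl

variable [IsManifold (𝓡 2) ∞ M]

theorem contDiffOn_comp_extChartAt_symm (F : C^∞⟮𝓡 2, M; 𝓘(ℝ, ℝ), ℝ⟯) (z₀ : M) :
    ContDiffOn ℝ ∞ (F ∘ (extChartAt (𝓡 2) z₀).symm) (extChartAt (𝓡 2) z₀).target :=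
  (F.contMDiff.comp_contMDiffOn (contMDiffOn_extChartAt_symm z₀)).contDiffOn

theorem mdifferentiableAt_extChartAt_symm {z₀ : M} {y : EuclideanSpace ℝ (Fin 2)}
    (hy : y ∈ (extChartAt (𝓡 2) z₀).target) :
    MDifferentiableAt 𝓘(ℝ, EuclideanSpace ℝ (Fin 2)) (𝓡 2) (extChartAt (𝓡 2) z₀).symm y :=
  ((contMDiffOn_extChartAt_symm (n := ∞) z₀).contMDiffAt
    ((isOpen_extChartAt_target z₀).mem_nhds hy)).mdifferentiableAt (by simp)

theorem fderiv_comp_extChartAt_symm (F : C^∞⟮𝓡 2, M; 𝓘(ℝ, ℝ), ℝ⟯) {z₀ : M}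
    {y : EuclideanSpace ℝ (Fin 2)} (hy : y ∈ (extChartAt (𝓡 2) z₀).target)
    (u : EuclideanSpace ℝ (Fin 2)) :
    fderiv ℝ (F ∘ (extChartAt (𝓡 2) z₀).symm) y u =
      differential F ((extChartAt (𝓡 2) z₀).symm y)
        (mfderiv 𝓘(ℝ, EuclideanSpace ℝ (Fin 2)) (𝓡 2) (extChartAt (𝓡 2) z₀).symm y u) := by
  rw [← mfderiv_eq_fderiv]
  exact mfderiv_comp_apply y (F.contMDiff.mdifferentiableAt (by simp))
    (mdifferentiableAt_extChartAt_symm hy) u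

/-- The inverse chart has invertible differential, so the coordinate frame maps to a basis, on which
a nondegenerate form cannot vanish. -/
theorem SymplecticForm.coefficient_ne_zero (Ω : SymplecticForm 2 M) {z₀ : M}
    {y : EuclideanSpace ℝ (Fin 2)} (hy : y ∈ (extChartAt (𝓡 2) z₀).target) :
    Ω.coefficient z₀ y ≠ 0 := by
  intro h
  rw [Ω.coefficient_eq] at h
  have hinv := isInvertible_mfderivWithin_extChartAt_symm (I := 𝓡 2) hy
  rw [ModelWithCorners.range_eq_univ, mfderivWithin_univ] at hinv
  obtain ⟨e, he⟩ := hinv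
  rw [← he] at h
  refine Ω.apply_basis_ne_zero ((extChartAt (𝓡 2) z₀).symm y) ?_
  obtain ⟨u, hu⟩ := e.surjective (tangentBasisVector ((extChartAt (𝓡 2) z₀).symm y) 0)
  obtain ⟨u', hu'⟩ := e.surjective (tangentBasisVector ((extChartAt (𝓡 2) z₀).symm y) 1)
  obtain ⟨a, b, hab⟩ := euclideanSpace_fin_two_decomp u
  obtain ⟨a', b', hab'⟩ := euclideanSpace_fin_two_decomp u'
  have h1 := e.map_add (a • EuclideanSpace.single (0 : Fin 2) (1 : ℝ))
      (b • EuclideanSpace.single (1 : Fin 2) (1 : ℝ))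
  have h2 := e.map_add (a' • EuclideanSpace.single (0 : Fin 2) (1 : ℝ))
      (b' • EuclideanSpace.single (1 : Fin 2) (1 : ℝ))
  rw [← hu, ← hu', hab, hab']
  erw [h1, h2, e.map_smul, e.map_smul, e.map_smul, e.map_smul, form_comb]
  exact mul_eq_zero_of_right _ h

/-- Pull `-dF ∧ dG = {F, G} Ω` back to the chart. Absolute values remove the sign and the
orientation, leaving `|Ω.coefficient z₀|` as the density. -/
theorem jacobianPair_comp_extChartAt_symm (Ω : SymplecticForm 2 M)
    (F G : C^∞⟮𝓡 2, M; 𝓘(ℝ, ℝ), ℝ⟯) {z₀ : M} {y : EuclideanSpace ℝ (Fin 2)}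
    (hy : y ∈ (extChartAt (𝓡 2) z₀).target) :
    |jacobianPair (EuclideanSpace.single (0 : Fin 2) (1 : ℝ))
      (EuclideanSpace.single (1 : Fin 2) (1 : ℝ)) (F ∘ (extChartAt (𝓡 2) z₀).symm)
      (G ∘ (extChartAt (𝓡 2) z₀).symm) y| =
    |poissonBracket Ω F G ((extChartAt (𝓡 2) z₀).symm y)| * |Ω.coefficient z₀ y| := by
  rw [← abs_mul, Ω.coefficient_eq,
    ← (eq_poissonBracket_iff Ω F G ((extChartAt (𝓡 2) z₀).symm y) _).1 rfl, abs_neg]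
  simp only [jacobianPair, fderiv_comp_extChartAt_symm _ hy, wedgeDifferentials]

/-- If `|{F, G}|` exceeds `c` somewhere, so does `|{F', G'}|` for all `F'`, `G'` close to `F`, `G`. -/
theorem exists_lt_abs_poissonBracket (Ω : SymplecticForm 2 M) (F G : C^∞⟮𝓡 2, M; 𝓘(ℝ, ℝ), ℝ⟯)
    {c : ℝ} (hc : 0 ≤ c) {z₀ : M} (hz₀ : c < |poissonBracket Ω F G z₀|) :
    ∃ ε > 0, ∀ F' G' : C^∞⟮𝓡 2, M; 𝓘(ℝ, ℝ), ℝ⟯,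
      (∀ z, |F z - F' z| < ε) → (∀ z, |G z - G' z| < ε) →
      ∃ z, c < |poissonBracket Ω F' G' z| := by
  have hy₀ := mem_extChartAt_target (I := 𝓡 2) z₀
  obtain ⟨ε, hε, h⟩ := exists_lt_abs_jacobianPair_on euclideanSpace_fin_two_decomp
    (isOpen_extChartAt_target z₀) (contDiffOn_comp_extChartAt_symm F z₀)
    (contDiffOn_comp_extChartAt_symm G z₀) (ρ := fun y => |Ω.coefficient z₀ y|)
    (Ω.continuousOn_coefficient z₀).abs (fun y => abs_nonneg _) hy₀ hc (by
      rw [jacobianPair_comp_extChartAt_symm Ω F G hy₀, extChartAt_to_inv]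
      exact mul_lt_mul_of_pos_right hz₀ (abs_pos.2 (Ω.coefficient_ne_zero hy₀)))
  refine ⟨ε, hε, fun F' G' hFF hGG => ?_⟩
  obtain ⟨y, hy, hlt⟩ := h _ _ (contDiffOn_comp_extChartAt_symm F' z₀)
    (contDiffOn_comp_extChartAt_symm G' z₀) (fun y _ => hFF _) (fun y _ => hGG _)
  rw [jacobianPair_comp_extChartAt_symm Ω F' G' hy] at hlt
  exact ⟨_, lt_of_mul_lt_mul_right hlt (abs_nonneg _)⟩

end Surface

theorem theorem1p4 {M : Type*} [TopologicalSpace M]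
    [ChartedSpace (EuclideanSpace ℝ (Fin 2)) M] [IsManifold (𝓡 2) ∞ M]
    (Ω : SymplecticForm 2 M) (F G : C^∞⟮𝓡 2, M; 𝓘(ℝ, ℝ), ℝ⟯) :
    upsilon Ω F G = supNorm (poissonBracket Ω F G) := by
  apply le_antisymm
  · unfold upsilon
    refine Filter.liminf_le_of_frequently_le' (Filter.Eventually.frequently ?_)
    filter_upwards [self_mem_nhdsWithin] with ε hε
    have h0 : ∀ H : M → ℝ, supNorm (fun z => H z - H z) < ENNReal.ofReal ε := fun H => by
      simpa [supNorm] using hε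
    exact iInf₂_le_of_le F G (iInf₂_le_of_le (h0 F) (h0 G) le_rfl)
  -- Comparing with levels below the supremum covers the unbounded case: a level `c'` exceeded at
  -- some point is finite.
  · refine le_of_forall_lt fun c hc => ?_
    obtain ⟨c', hcc', hc'⟩ := exists_between hc
    refine hcc'.trans_le ?_
    obtain ⟨z₀, hz₀⟩ := lt_iSup_iff.1 hc'
    lift c' to NNReal using (hz₀.trans_le le_top).ne
    obtain ⟨ε₀, hε₀, h⟩ := exists_lt_abs_poissonBracket Ω F G c'.2 (z₀ := z₀) (by
      rw [Real.enorm_eq_ofReal_abs] at hz₀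
      exact (ENNReal.lt_ofReal_iff_toReal_lt ENNReal.coe_ne_top).1 hz₀)
    unfold upsilon
    refine Filter.le_liminf_of_le (by isBoundedDefault) ?_
    filter_upwards [Ioo_mem_nhdsGT hε₀] with ε hε
    refine le_iInf₂ fun F' G' => le_iInf₂ fun hF' hG' => ?_
    obtain ⟨z, hz⟩ := h F' G' (fun z => (abs_lt_of_supNorm_lt hF' z).trans hε.2)
      (fun z => (abs_lt_of_supNorm_lt hG' z).trans hε.2)
    refine le_iSup_of_le z ?_
    rw [Real.enorm_eq_ofReal_abs]
    exact ((ENNReal.lt_ofReal_iff_toReal_lt ENNReal.coe_ne_top).2 hz).le
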